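/- **Corollary 1.1.** For all real numbers $0<t\le 1$ and $0<R_1\le R_2<\infty$ there is an integer $c=c(t,R_1,R_2)\ge 1$, depending only on $t,R_1,R_2$, with the following property. Let $\Omega$ be a locally compact Hausdorff space with a Borel probability measure $\mu$, and let $\mathcal D_N=\{\varphi_j\}_{j=1}^N$ be measurable functions $\Omega\to\mathbb C$ with $|\varphi_j(x)|\le 1$ for all $x\in\Omega$ and all $j$, such that for all $a\in\mathbb C^N$ $$R_1\Bigl(\sum_{j=1}^N|a_j|^2\Bigr)^{1/2}\le\Bigl\|\sum_{j=1}^N a_j\varphi_j\Bigr\|_{L_2(\Omega,\mu)}\le R_2\Bigl(\sum_{j=1}^N|a_j|^2\Bigr)^{1/2}.$$ For $1\le s\le N$ let $\Sigma_s(\mathcal D_N)$ be the union of the linear spaces $\operatorname{span}\{\varphi_j:j\in J\}$ of functions on $\Omega$ over all $J\subset\{1,\dots,N\}$ with $|J|=s$. Let $1\le u\le N$ be an integer and let $\xi^1,\dots,\xi^m\in\Omega$ be points such that $$\tfrac12\|f\|_{L_2(\Omega,\mu)}^2\le\frac1m\sum_{\nu=1}^m|f(\xi^\nu)|^2\le\tfrac32\|f\|_{L_2(\Omega,\mu)}^2\qquad\text{for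 all } f\in\Sigma_u(\mathcal D_N).$$ Put $\Omega_m=\{\xi^1,\dots,\xi^m\}$ and $\mu_m=\frac1m\sum_{\nu=1}^m\delta_{\xi^\nu}$; all restrictions $\varphi_j|_{\Omega_m}$ are then nonzero in $H:=L_2(\Omega_m,\mu_m)$. Let $v$ be a positive integer with $(1+c)v\le u$, let $f_0\in\Sigma_v(\mathcal D_N)$, and apply to $f_0|_{\Omega_m}$ the Weak Orthogonal Matching Pursuit in $H$ with the dictionary $\{\varphi_j|_{\Omega_m}\}_{j=1}^N$ and weakness parameter $t$. That is, with $r_0=f_0|_{\Omega_m}$ and $\psi_i=\varphi_i|_{\Omega_m}/\|\varphi_i|_{\Omega_m}\|_H$, for $k=1,2,\dots$ choose any index $j_k$ with $$|\langle r_{k-1},\psi_{j_k}\rangle_H|\ge t\,\max_{1\le i\le N}|\langle r_{k-1},\psi_i\rangle_H|,$$ let $G_k$ be the orthogonal projection of $f_0|_{\Omega_m}$ onto $\operatorname{span}\{\varphi_{j_1}|_{\Omega_m},\dots,\varphi_{j_k}|_{\Omega_m}\}$, and let $r_k=f_0|_{\Omega_m}-G_k$. Then, for every possible choice of the indices $j_k$,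 the algorithm recovers $f_0$ exactly after $cv$ iterations: $r_{cv}=0$ in $H$, and $f_0$ is the unique function $g\in\operatorname{span}\{\varphi_{j_1},\dots,\varphi_{j_{cv}}\}$ on $\Omega$ with $g|_{\Omega_m}=G_{cv}$. -/

import Mathlib

open MeasureTheory
open scoped ENNReal InnerProductSpace

noncomputable section

/-! ### Sparse functions with respect to a finite dictionary -/

/-- The collection `𝒳_v(D_N)` of all linear spaces `span {φ_j : j ∈ J}`, `|J| = v`,
of functions on `Ω`. -/
def sparseSpaces {Ω : Type*} {N : ℕ} (φ : Fin N → Ω → ℂ) (v : ℕ) :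
    Set (Submodule ℂ (Ω → ℂ)) :=
  {V | ∃ J : Finset (Fin N), J.card = v ∧ V = Submodule.span ℂ (φ '' (J : Set (Fin N)))}

/-- The set `Σ_v(D_N)` of all `v`-sparse functions. -/
def sparseFunctions {Ω : Type*} {N : ℕ} (φ : Fin N → Ω → ℂ) (v : ℕ) : Set (Ω → ℂ) :=
  ⋃ V ∈ sparseSpaces φ v, (V : Set (Ω → ℂ))

/-- The `L_2(Ω, μ)` norm, as a real number. -/
def l2norm {Ω : Type*} [MeasurableSpace Ω] (μ : Measure Ω) (f : Ω → ℂ) : ℝ :=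
  (eLpNorm f 2 μ).toReal

/-- Uniformly bounded Riesz basis with constants `R₁, R₂`: (measurable) functions on `Ω`, bounded
by `1` everywhere, with two-sided Riesz inequalities in `L_2(Ω, μ)`. -/
structure IsUniformlyBoundedRieszBasis {Ω : Type*} [MeasurableSpace Ω] (μ : Measure Ω) {N : ℕ}
    (φ : Fin N → Ω → ℂ) (R₁ R₂ : ℝ) : Prop where
  aestronglyMeasurable : ∀ j, AEStronglyMeasurable (φ j) μ
  bound : ∀ j x, ‖φ j x‖ ≤ 1
  lower : ∀ a : Fin N → ℂ,
    R₁ * Real.sqrt (∑ j, ‖a j‖ ^ 2) ≤ l2norm μ (fun x => ∑ j, a j * φ j x)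
  upper : ∀ a : Fin N → ℂ,
    l2norm μ (fun x => ∑ j, a j * φ j x) ≤ R₂ * Real.sqrt (∑ j, ‖a j‖ ^ 2)

/-- The points `ξ^1, …, ξ^m` provide universal discretization (of the `L_2` norm, with constants
`1/2` and `3/2`) for a collection `𝒳` of linear spaces of functions on `Ω`. -/
def UniversalDiscretization {Ω : Type*} [MeasurableSpace Ω] (μ : Measure Ω) {m : ℕ}
    (ξ : Fin m → Ω) (𝒳 : Set (Submodule ℂ (Ω → ℂ))) : Prop :=
  ∀ V ∈ 𝒳, ∀ f ∈ V,
    (1 / 2 : ℝ) * l2norm μ f ^ 2 ≤ (1 / (m : ℝ)) * ∑ ν, ‖f (ξ ν)‖ ^ 2 ∧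
    (1 / (m : ℝ)) * ∑ ν, ‖f (ξ ν)‖ ^ 2 ≤ (3 / 2 : ℝ) * l2norm μ f ^ 2

/-! ### The discrete Hilbert space `L_2(Ω_m, μ_m)`, where `Ω_m = Set.range ξ` -/

/-- The uniform probability measure `μ_m = (1/m) ∑ δ_{ξ^ν}` on `Ω_m`; for pairwise distinct points
it gives mass `1/m` to each of them. -/
def sampleMeasure {Ω : Type*} [MeasurableSpace Ω] {m : ℕ} (ξ : Fin m → Ω) :
    Measure (Set.range ξ) :=
  (m : ℝ≥0∞)⁻¹ • ∑ ν, Measure.dirac (⟨ξ ν, ν, rfl⟩ : Set.range ξ)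

instance sampleMeasure_isFiniteMeasure {Ω : Type*} [MeasurableSpace Ω] {m : ℕ} (ξ : Fin m → Ω) :
    IsFiniteMeasure (sampleMeasure ξ) := by
  rcases Nat.eq_zero_or_pos m with h | h
  · subst h
    refine ⟨?_⟩
    simp [sampleMeasure]
  · refine ⟨?_⟩
    simp only [sampleMeasure, Measure.smul_apply, Measure.finsetSum_apply, measure_univ,
      smul_eq_mul]
    refine ENNReal.mul_lt_top ?_ ?_
    · exact ENNReal.inv_lt_top.2 (by exact_mod_cast h)
    · simp

/-- Every function on `Ω_m` is square integrable. -/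
lemma memLp_sampleMeasure {Ω : Type*} [MeasurableSpace Ω] [MeasurableSingletonClass Ω] {m : ℕ}
    (ξ : Fin m → Ω) (g : Set.range ξ → ℂ) : MemLp g 2 (sampleMeasure ξ) := by
  obtain ⟨C, hC⟩ := (Set.finite_range (fun x => ‖g x‖)).bddAbove
  refine MemLp.of_bound (measurable_of_finite g).aestronglyMeasurable C ?_
  exact Filter.Eventually.of_forall fun x => hC ⟨x, rfl⟩

/-- The restriction of a function to `Ω_m`, as an element of `L_2(Ω_m, μ_m)`. -/
def sampleRestrict {Ω : Type*} [MeasurableSpace Ω] [MeasurableSingletonClass Ω] {m : ℕ}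
    (ξ : Fin m → Ω) (f : Ω → ℂ) : Lp ℂ 2 (sampleMeasure ξ) :=
  (memLp_sampleMeasure ξ (fun x => f x)).toLp _

/-! ### Weak Orthogonal Matching Pursuit in an inner product space -/

section WOMP

variable {H : Type*} [NormedAddCommGroup H] [InnerProductSpace ℂ H] {I : Type*}

/-- `H_k = span {D_{j_1}, …, D_{j_k}}`; the index selected at iteration `i + 1` is `j i`. -/
def wompSpace (D : I → H) (j : ℕ → I) (k : ℕ) : Submodule ℂ H :=
  Submodule.span ℂ ((fun i => D (j i)) '' Set.Iio k)

instance wompSpace_finiteDimensional (D : I → H) (j : ℕ → I) (k : ℕ) :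
    FiniteDimensional ℂ (wompSpace D j k) :=
  FiniteDimensional.span_of_finite ℂ ((Set.finite_Iio k).image _)

/-- `G_k(f₀)`, the orthogonal projection of `f₀` onto `H_k`. -/
def wompApprox (D : I → H) (f₀ : H) (j : ℕ → I) (k : ℕ) : H :=
  (wompSpace D j k).starProjection f₀

/-- The residual `f_k = f₀ - G_k(f₀)` after `k` iterations (for `k = 0` it is `f₀`). -/
def wompResidual (D : I → H) (f₀ : H) (j : ℕ → I) (k : ℕ) : H :=
  f₀ - wompApprox D f₀ j k

/-- `j` is a possible sequence of selections of the WOMP with dictionary `D` and weakness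
parameter `t`, applied to `f₀`: for every `k`,
`|⟨f_k, ψ_{j_{k+1}}⟩| ≥ t * sup_i |⟨f_k, ψ_i⟩|`, where `ψ_i = D_i / ‖D_i‖`. -/
def IsWOMP (D : I → H) (t : ℝ) (f₀ : H) (j : ℕ → I) : Prop :=
  ∀ k : ℕ,
    t * ⨆ i : I, ‖⟪((‖D i‖ : ℂ)⁻¹ • D i), wompResidual D f₀ j k⟫_ℂ‖ ≤
      ‖⟪((‖D (j k)‖ : ℂ)⁻¹ • D (j k)), wompResidual D f₀ j k⟫_ℂ‖

end WOMP

end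

/-! Discretization combined with the Riesz inequalities makes the sampled dictionary a system with
the restricted isometry property, with constants `α = R₁² / 2` and `β = 3 R₂² / 2`, on supports of
size at most `u`. The rest is a statement about greedy selection in an inner product space.

As long as the residual exceeds the error of a sparse competitor, one iteration removes a fixed
proportion of the gap, inversely proportional to the number of competitor indices not yet selected
(`IsWOMP.gap_le`). Hence a number of iterations proportional to that count shrinks the gap by any
prescribed factor (`IsWOMP.norm_residual_sq_le_add`).

Let `n` indices of the support `T` be missing. If, for some `m`, a block of `C * m` iterations finds
at least `m` of them, the block is paid for and induction on `n` applies. Otherwise few indices are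
found at every dyadic scale. Then the selected part of `T` is a competitor with few missing indices,
so the residual approaches its error quickly; but that error is also at most `β / α` times a later
residual, so the residual cannot fall fast. Using all of `T`, a competitor of error zero, at the
last scale forces a fast fall. Both are possible only if the residual is zero.

Finally, the lower isometry bound on the union of `T` and the selected set lifts the identity from
the sample to `Ω`. -/

section SpanFinset

variable {R M I : Type*} [Semiring R] [AddCommMonoid M] [Module R M]

lemma exists_coeff_of_mem_span_image {v : I → M} {J : Finset I} {x : M}
    (hx : x ∈ Submodule.span R (v '' (J : Set I))) :
    ∃ a : I → R, (∀ i ∉ J, a i = 0) ∧ ∑ i ∈ J, a i • v i = x := by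
  classical
  obtain ⟨c, rfl⟩ := (Submodule.mem_span_image_finset_iff_exists_fun R).1 hx
  refine ⟨fun i => if h : i ∈ J then c ⟨i, h⟩ else 0, fun i hi => by simp [hi], ?_⟩
  rw [← Finset.sum_coe_sort J]
  exact Finset.sum_congr rfl fun i _ => by simp

lemma sum_smul_mem_span_image {v : I → M} {J : Finset I} {s : Set I} (h : ↑J ⊆ s) (a : I → R) :
    ∑ i ∈ J, a i • v i ∈ Submodule.span R (v '' s) :=
  Submodule.sum_mem _ fun i hi =>
    Submodule.smul_mem _ _ (Submodule.subset_span ⟨i, h (by exact_mod_cast hi), rfl⟩)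

end SpanFinset

/-- The restricted isometry property with constants `α, β` for combinations of at most `K` elements
of the system `D`. -/
def RestrictedIsometry {H : Type*} [NormedAddCommGroup H] [InnerProductSpace ℂ H] {I : Type*}
    (D : I → H) (α β : ℝ) (K : ℕ) : Prop :=
  ∀ J : Finset I, J.card ≤ K → ∀ a : I → ℂ,
    α * ∑ i ∈ J, ‖a i‖ ^ 2 ≤ ‖∑ i ∈ J, a i • D i‖ ^ 2 ∧
      ‖∑ i ∈ J, a i • D i‖ ^ 2 ≤ β * ∑ i ∈ J, ‖a i‖ ^ 2

/-! ### Matching pursuit: orthogonality, monotonicity and the gain of one iteration -/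

section WOMP

variable {H : Type*} [NormedAddCommGroup H] [InnerProductSpace ℂ H] {I : Type*}

/-- The set of indices selected during the first `k` iterations. -/
def selectedIndices [DecidableEq I] (j : ℕ → I) (k : ℕ) : Finset I := (Finset.range k).image j

lemma selectedIndices_mono [DecidableEq I] (j : ℕ → I) : Monotone (selectedIndices j) :=
  fun _ _ h => Finset.image_subset_image (Finset.range_mono h)

lemma card_selectedIndices_le [DecidableEq I] (j : ℕ → I) (k : ℕ) :
    (selectedIndices j k).card ≤ k :=
  Finset.card_image_le.trans (Finset.card_range k).le

lemma image_selectedIndices [DecidableEq I] {M : Type*} (D : I → M) (j : ℕ → I) (k : ℕ) :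
    D '' (selectedIndices j k : Set I) = (fun i => D (j i)) '' Set.Iio k := by
  simp [selectedIndices, Set.image_image]

lemma wompSpace_eq [DecidableEq I] (D : I → H) (j : ℕ → I) (k : ℕ) :
    wompSpace D j k = Submodule.span ℂ (D '' (selectedIndices j k : Set I)) := by
  rw [image_selectedIndices, wompSpace]

lemma wompSpace_mono (D : I → H) (j : ℕ → I) : Monotone (wompSpace D j) :=
  fun _ _ h => Submodule.span_mono (Set.image_mono (Set.Iio_subset_Iio h))

lemma wompApprox_mem (D : I → H) (f₀ : H) (j : ℕ → I) (k : ℕ) :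
    wompApprox D f₀ j k ∈ wompSpace D j k :=
  Submodule.starProjection_apply_mem _ _

lemma inner_wompResidual (D : I → H) (f₀ : H) (j : ℕ → I) (k : ℕ) {g : H}
    (hg : g ∈ wompSpace D j k) : ⟪g, wompResidual D f₀ j k⟫_ℂ = 0 :=
  (Submodule.mem_orthogonal _ _).1 (Submodule.sub_starProjection_mem_orthogonal f₀) g hg

lemma norm_wompResidual_le (D : I → H) (f₀ : H) (j : ℕ → I) (k : ℕ) {g : H}
    (hg : g ∈ wompSpace D j k) : ‖wompResidual D f₀ j k‖ ≤ ‖f₀ - g‖ := by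
  have h := Submodule.starProjection_minimal (U := wompSpace D j k) f₀
  rw [wompResidual, wompApprox, h]
  exact ciInf_le (f := fun x : wompSpace D j k => ‖f₀ - x‖)
    ⟨0, by rintro _ ⟨x, rfl⟩; positivity⟩ ⟨g, hg⟩

lemma norm_wompResidual_antitone (D : I → H) (f₀ : H) (j : ℕ → I) :
    Antitone fun k => ‖wompResidual D f₀ j k‖ := fun _ _ h =>
  norm_wompResidual_le D f₀ j _ (wompSpace_mono D j h (wompApprox_mem D f₀ j _))

lemma norm_inv_norm_smul_le_one (x : H) : ‖(‖x‖ : ℂ)⁻¹ • x‖ ≤ 1 := by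
  rw [norm_smul, norm_inv, Complex.norm_real, norm_norm]
  exact inv_mul_le_one

/-- One iteration decreases the squared residual at least by the squared inner product with the
selected normalised element. -/
lemma norm_wompResidual_succ_sq_le (D : I → H) (f₀ : H) (j : ℕ → I) (k : ℕ) :
    ‖wompResidual D f₀ j (k + 1)‖ ^ 2 ≤ ‖wompResidual D f₀ j k‖ ^ 2 -
      ‖⟪((‖D (j k)‖ : ℂ)⁻¹ • D (j k)), wompResidual D f₀ j k⟫_ℂ‖ ^ 2 := by
  set r := wompResidual D f₀ j k with hr
  set ψ := (‖D (j k)‖ : ℂ)⁻¹ • D (j k) with hψ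
  have hψ1 : ‖ψ‖ ≤ 1 := norm_inv_norm_smul_le_one _
  -- A single greedy correction along `ψ` already lies in the next space, and the projection does at
  -- least as well. Only `‖ψ‖ ≤ 1` is needed, so a zero dictionary element is harmless.
  have hmem : wompApprox D f₀ j k + ⟪ψ, r⟫_ℂ • ψ ∈ wompSpace D j (k + 1) := by
    refine Submodule.add_mem _ (wompSpace_mono D j k.le_succ (wompApprox_mem D f₀ j k)) ?_
    refine Submodule.smul_mem _ _ (Submodule.smul_mem _ _ (Submodule.subset_span ?_))
    exact ⟨k, Set.mem_Iio.2 k.lt_succ_self, rfl⟩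
  have h1 := norm_wompResidual_le D f₀ j (k + 1) hmem
  rw [← sub_sub] at h1
  change _ ≤ ‖r - ⟪ψ, r⟫_ℂ • ψ‖ at h1
  have h2 : ‖r - ⟪ψ, r⟫_ℂ • ψ‖ ^ 2 =
      ‖r‖ ^ 2 - 2 * ‖⟪ψ, r⟫_ℂ‖ ^ 2 + ‖⟪ψ, r⟫_ℂ‖ ^ 2 * ‖ψ‖ ^ 2 := by
    rw [norm_sub_sq (𝕜 := ℂ), inner_smul_right, norm_smul, mul_pow, ← inner_conj_symm r ψ,
      RCLike.mul_conj]
    norm_cast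
  have h3 : ‖ψ‖ ^ 2 ≤ 1 := pow_le_one₀ (norm_nonneg _) hψ1
  have h4 := mul_le_mul_of_nonneg_left h3 (sq_nonneg ‖⟪ψ, r⟫_ℂ‖)
  have h5 := pow_le_pow_left₀ (norm_nonneg _) h1 2
  linarith

/-- By the arithmetic-geometric mean inequality, `4 * d * (α * A) ≤ (d + α * A) ^ 2`, and `A`
cancels. If `A = 0`, the hypothesis forces `d = 0`. This removes the unknown coefficient mass `A`
from the estimate of the gap. -/
lemma le_of_add_sq_le {A P d α : ℝ} (hA : 0 ≤ A) (hP : 0 ≤ P) (hd : 0 ≤ d)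
    (h : (d + α * A) ^ 2 ≤ 4 * (P * A)) : d * α ≤ P := by
  rcases hA.eq_or_lt with h0 | h0
  · have : d ^ 2 ≤ 0 := by simpa [← h0] using h
    have : d = 0 := by nlinarith
    simpa [this] using hP
  · have h1 : 4 * (d * α * A) ≤ 4 * (P * A) := by nlinarith [sq_nonneg (d - α * A)]
    nlinarith

variable [Finite I] [DecidableEq I] {D : I → H} {α β t : ℝ} {K : ℕ} {f₀ : H} {j : ℕ → I}
  {T : Finset I} {x : I → ℂ}

/-- The gap between the squared residual and the squared error of a competitor supported on
`S` is controlled by the gain of one iteration. -/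
lemma IsWOMP.gap_le (hα : 0 < α) (hβ : 0 < β) (ht : 0 ≤ t) (hD : RestrictedIsometry D α β K)
    (hj : IsWOMP D t f₀ j) {k : ℕ} {S : Finset I}
    (hK : S.card + k ≤ K) (hgap : ‖f₀ - ∑ i ∈ S, x i • D i‖ ^ 2 ≤ ‖wompResidual D f₀ j k‖ ^ 2) :
    t ^ 2 * α * (‖wompResidual D f₀ j k‖ ^ 2 - ‖f₀ - ∑ i ∈ S, x i • D i‖ ^ 2) ≤
      β * (S \ selectedIndices j k).card *
        (‖wompResidual D f₀ j k‖ ^ 2 - ‖wompResidual D f₀ j (k + 1)‖ ^ 2) := by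
  set F := selectedIndices j k with hF
  set r := wompResidual D f₀ j k with hr
  set g := ∑ i ∈ S, x i • D i with hg
  set G := wompApprox D f₀ j k with hG
  set B := ⨆ i : I, ‖⟪((‖D i‖ : ℂ)⁻¹ • D i), r⟫_ℂ‖ with hB
  set A := ∑ i ∈ S \ F, ‖x i‖ ^ 2 with hA
  have hB0 : 0 ≤ B := Real.iSup_nonneg fun i => norm_nonneg _
  have hA0 : 0 ≤ A := Finset.sum_nonneg fun i _ => sq_nonneg _
  have hsucc := norm_wompResidual_succ_sq_le D f₀ j k
  have hsel : t * B ≤ _ := hj k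
  have hgain : t ^ 2 * B ^ 2 ≤ ‖r‖ ^ 2 - ‖wompResidual D f₀ j (k + 1)‖ ^ 2 := by
    have := pow_le_pow_left₀ (mul_nonneg ht hB0) hsel 2
    rw [mul_pow] at this
    linarith
  have hFK : F.card ≤ k := card_selectedIndices_le j k
  -- lower bound of the distance to the competitor
  have hlow : α * A ≤ ‖g - G‖ ^ 2 := by
    have hGm : G ∈ Submodule.span ℂ (D '' (F : Set I)) := by
      rw [← wompSpace_eq]; exact wompApprox_mem D f₀ j k
    obtain ⟨y, -, hyG⟩ := exists_coeff_of_mem_span_image hGm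
    -- These are coefficients of `g - G`; off `F` they agree with `x`, so the lower isometry bound
    -- on `S ∪ F` controls `A`.
    set z : I → ℂ := fun i => (if i ∈ S then x i else 0) - (if i ∈ F then y i else 0) with hz
    have hsum : ∑ i ∈ S ∪ F, z i • D i = g - G := by
      simp only [hz, sub_smul, Finset.sum_sub_distrib, ite_smul, zero_smul,
        Finset.sum_ite_mem, Finset.union_inter_cancel_left, Finset.union_inter_cancel_right]
      rw [hyG]
    have h := (hD (S ∪ F) ((Finset.card_union_le _ _).trans (by omega)) z).1
    rw [hsum] at h
    refine le_trans (mul_le_mul_of_nonneg_left ?_ hα.le) h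
    calc A = ∑ i ∈ S \ F, ‖z i‖ ^ 2 := Finset.sum_congr rfl fun i hi => by
            simp [hz, (Finset.mem_sdiff.1 hi).1, (Finset.mem_sdiff.1 hi).2]
      _ ≤ _ := Finset.sum_le_sum_of_subset_of_nonneg
            (Finset.sdiff_subset.trans Finset.subset_union_left) fun i _ _ => sq_nonneg _
  -- the inner product of the residual with the competitor
  have hD1 : ∀ i ∈ S, ‖D i‖ ≤ √β := fun i hi => by
    have h := (hD {i} (by
      have := Finset.card_pos.2 ⟨i, hi⟩
      rw [Finset.card_singleton]; omega) 1).2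
    exact Real.le_sqrt_of_sq_le (by simpa using h)
  have hinner : ∀ i ∈ S, ‖⟪D i, r⟫_ℂ‖ ≤ √β * B := fun i hi => by
    rcases eq_or_ne (D i) 0 with h0 | h0
    · simpa [h0] using mul_nonneg (Real.sqrt_nonneg _) hB0
    · have h1 : ‖⟪((‖D i‖ : ℂ)⁻¹ • D i), r⟫_ℂ‖ ≤ B :=
        le_ciSup (f := fun i => ‖⟪((‖D i‖ : ℂ)⁻¹ • D i), r⟫_ℂ‖) (Set.finite_range _).bddAbove i
      rw [inner_smul_left, norm_mul, RCLike.norm_conj, norm_inv, Complex.norm_real, norm_norm,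
        inv_mul_le_iff₀ (norm_pos_iff.2 h0)] at h1
      exact h1.trans (mul_le_mul_of_nonneg_right (hD1 i hi) hB0)
  have hup : ‖⟪g - G, r⟫_ℂ‖ ≤ √β * B * ∑ i ∈ S \ F, ‖x i‖ := by
    have hS : ⟪g - G, r⟫_ℂ = ∑ i ∈ S \ F, ⟪x i • D i, r⟫_ℂ := by
      rw [inner_sub_left, inner_wompResidual D f₀ j k (wompApprox_mem D f₀ j k), sub_zero, hg,
        sum_inner]
      refine (Finset.sum_subset Finset.sdiff_subset fun i hi hi' => ?_).symm
      have hiF : i ∈ F := by simpa [hi] using hi'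
      refine inner_wompResidual D f₀ j k (Submodule.smul_mem _ _ ?_)
      rw [wompSpace_eq]
      exact Submodule.subset_span ⟨i, by exact_mod_cast hiF, rfl⟩
    rw [hS, Finset.mul_sum]
    refine norm_sum_le_of_le _ fun i hi => ?_
    rw [inner_smul_left, norm_mul, RCLike.norm_conj, mul_comm]
    exact mul_le_mul_of_nonneg_right (hinner i (Finset.mem_sdiff.1 hi).1) (norm_nonneg _)
  -- Expanding the square turns the gap `d` into `d + ‖g - G‖ ^ 2 = 2 Re ⟪g - G, r⟫`, which the two
  -- preceding bounds estimate from both sides.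
  have hpol : ‖f₀ - g‖ ^ 2 = ‖r‖ ^ 2 - 2 * RCLike.re ⟪g - G, r⟫_ℂ + ‖g - G‖ ^ 2 := by
    have : f₀ - g = r - (g - G) := by rw [hr, wompResidual]; abel
    rw [this, norm_sub_sq (𝕜 := ℂ), inner_re_symm]
  have hre := (RCLike.re_le_norm ⟪g - G, r⟫_ℂ).trans hup
  set d := ‖r‖ ^ 2 - ‖f₀ - g‖ ^ 2 with hd
  have hd0 : 0 ≤ d := sub_nonneg.2 hgap
  have hcs : (∑ i ∈ S \ F, ‖x i‖) ^ 2 ≤ (S \ F).card * A := sq_sum_le_card_mul_sum_sq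
  have hdA : d + α * A ≤ 2 * (√β * B * ∑ i ∈ S \ F, ‖x i‖) := by linarith
  have hsq := pow_le_pow_left₀ (add_nonneg hd0 (mul_nonneg hα.le hA0)) hdA 2
  have hkey : d * α ≤ β * B ^ 2 * (S \ F).card := by
    refine le_of_add_sq_le hA0 (by positivity) hd0 (hsq.trans ?_)
    rw [mul_pow, mul_pow, mul_pow, Real.sq_sqrt hβ.le]
    have := mul_le_mul_of_nonneg_left hcs (by positivity : 0 ≤ β * B ^ 2)
    linarith
  calc t ^ 2 * α * d = t ^ 2 * (d * α) := by ring
    _ ≤ t ^ 2 * (β * B ^ 2 * (S \ F).card) := mul_le_mul_of_nonneg_left hkey (sq_nonneg t)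
    _ = β * (S \ F).card * (t ^ 2 * B ^ 2) := by ring
    _ ≤ _ := mul_le_mul_of_nonneg_left hgain (by positivity)

end WOMP

/-! ### Exact recovery under restricted isometry: decay, dyadic scales, induction on missing indices
-/

section Recovery

variable {H : Type*} [NormedAddCommGroup H] [InnerProductSpace ℂ H] {I : Type*}
  {D : I → H} {α β t : ℝ} {K : ℕ} {f₀ : H} {j : ℕ → I}
  {T : Finset I} {x : I → ℂ}

lemma norm_wompResidual_sq_antitone (D : I → H) (f₀ : H) (j : ℕ → I) :
    Antitone fun k => ‖wompResidual D f₀ j k‖ ^ 2 := fun _ _ h =>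
  pow_le_pow_left₀ (norm_nonneg _) (norm_wompResidual_antitone D f₀ j h) 2

variable [DecidableEq I]

/-- The error of the restriction of a sparse representation to the indices selected during the
first `s` iterations is comparable with the residual. -/
lemma norm_sub_sum_inter_sq_le (hα : 0 < α) (hβ : 0 < β) (hD : RestrictedIsometry D α β K)
    (hf : f₀ = ∑ i ∈ T, x i • D i) {s : ℕ} (hK : T.card + s ≤ K) :
    ‖f₀ - ∑ i ∈ T ∩ selectedIndices j s, x i • D i‖ ^ 2 ≤
      β / α * ‖wompResidual D f₀ j s‖ ^ 2 := by
  set F := selectedIndices j s with hF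
  have hFs : F.card ≤ s := card_selectedIndices_le j s
  have h1 : f₀ - ∑ i ∈ T ∩ F, x i • D i = ∑ i ∈ T \ F, x i • D i := by
    rw [hf, ← Finset.sum_inter_add_sum_sdiff T F, add_sub_cancel_left]
  have hTF : (T \ F).card ≤ K := (Finset.card_le_card Finset.sdiff_subset).trans (by omega)
  have hGm : wompApprox D f₀ j s ∈ Submodule.span ℂ (D '' (F : Set I)) := by
    rw [← wompSpace_eq]; exact wompApprox_mem D f₀ j s
  obtain ⟨y, -, hyG⟩ := exists_coeff_of_mem_span_image hGm
  set z : I → ℂ := fun i => (if i ∈ T then x i else 0) - (if i ∈ F then y i else 0) with hz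
  have hsum : ∑ i ∈ T ∪ F, z i • D i = wompResidual D f₀ j s := by
    simp only [hz, sub_smul, Finset.sum_sub_distrib, ite_smul, zero_smul,
      Finset.sum_ite_mem, Finset.union_inter_cancel_left, Finset.union_inter_cancel_right]
    rw [hyG, ← hf, wompResidual]
  have h := (hD (T ∪ F) ((Finset.card_union_le _ _).trans (by omega)) z).1
  rw [hsum] at h
  have h2 : ∑ i ∈ T \ F, ‖x i‖ ^ 2 ≤ ∑ i ∈ T ∪ F, ‖z i‖ ^ 2 := by
    calc ∑ i ∈ T \ F, ‖x i‖ ^ 2 = ∑ i ∈ T \ F, ‖z i‖ ^ 2 := Finset.sum_congr rfl fun i hi => by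
            simp [hz, (Finset.mem_sdiff.1 hi).1, (Finset.mem_sdiff.1 hi).2]
      _ ≤ _ := Finset.sum_le_sum_of_subset_of_nonneg
            (Finset.sdiff_subset.trans Finset.subset_union_left) fun i _ _ => sq_nonneg _
  rw [h1, div_mul_eq_mul_div, le_div_iff₀ hα]
  have h3 := (hD (T \ F) hTF x).2
  have h4 := mul_le_mul_of_nonneg_left h2 hα.le
  have h5 := mul_le_mul_of_nonneg_left (h4.trans h) hβ.le
  have h6 := mul_le_mul_of_nonneg_right h3 hα.le
  linarith

variable [Finite I]

/-- Exponential decay of the squared residual towards the squared error of a competitor. -/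
lemma IsWOMP.norm_residual_sq_le_exp (hα : 0 < α) (hαβ : α ≤ β) (ht : 0 < t)
    (hD : RestrictedIsometry D α β K) (hj : IsWOMP D t f₀ j) {S : Finset I} {k p n : ℕ}
    (hn : 0 < n) (hS : (S \ selectedIndices j k).card ≤ n) (hK : S.card + (k + p) ≤ K) :
    ‖wompResidual D f₀ j (k + p)‖ ^ 2 ≤ ‖f₀ - ∑ i ∈ S, x i • D i‖ ^ 2 +
      Real.exp (-(t ^ 2 * α / (β * n) * p)) * ‖wompResidual D f₀ j k‖ ^ 2 := by
  have hβ : 0 < β := hα.trans_le hαβ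
  have hn' : (1 : ℝ) ≤ n := by exact_mod_cast hn
  set q := ‖f₀ - ∑ i ∈ S, x i • D i‖ ^ 2 with hq
  set ρ := t ^ 2 * α / (β * n) with hρ
  induction p with
  | zero =>
    have : 0 ≤ q := sq_nonneg _
    simpa using this
  | succ p ih =>
    have ih := ih (by omega)
    have hanti := norm_wompResidual_sq_antitone D f₀ j (k + p).le_succ
    simp only [Nat.succ_eq_add_one] at hanti
    rw [← add_assoc]
    rcases le_total (‖wompResidual D f₀ j (k + p)‖ ^ 2) q with h | h
    · exact (hanti.trans h).trans (le_add_of_nonneg_right (by positivity))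
    · have hgap := hj.gap_le hα hβ ht.le hD (by omega : S.card + (k + p) ≤ K) h
      have hcard : ((S \ selectedIndices j (k + p)).card : ℝ) ≤ n := by
        exact_mod_cast (Finset.card_le_card (Finset.sdiff_subset_sdiff le_rfl
          (selectedIndices_mono j (Nat.le_add_right k p)))).trans hS
      have h1 : t ^ 2 * α * (‖wompResidual D f₀ j (k + p)‖ ^ 2 - q) ≤
          β * n * (‖wompResidual D f₀ j (k + p)‖ ^ 2 - ‖wompResidual D f₀ j (k + p + 1)‖ ^ 2) :=
        hgap.trans (mul_le_mul_of_nonneg_right (mul_le_mul_of_nonneg_left hcard hβ.le)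
          (sub_nonneg.2 hanti))
      have h2 : ρ * (‖wompResidual D f₀ j (k + p)‖ ^ 2 - q) ≤
          ‖wompResidual D f₀ j (k + p)‖ ^ 2 - ‖wompResidual D f₀ j (k + p + 1)‖ ^ 2 := by
        rw [hρ, div_mul_eq_mul_div, div_le_iff₀ (by positivity), mul_comm _ (β * (n : ℝ))]
        exact h1
      have h3 : (1 - ρ) * (‖wompResidual D f₀ j (k + p)‖ ^ 2 - q) ≤
          Real.exp (-ρ) * (‖wompResidual D f₀ j (k + p)‖ ^ 2 - q) :=
        mul_le_mul_of_nonneg_right (Real.one_sub_le_exp_neg ρ) (sub_nonneg.2 h)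
      have h4 : Real.exp (-ρ) * (‖wompResidual D f₀ j (k + p)‖ ^ 2 - q) ≤
          Real.exp (-ρ) * (Real.exp (-(ρ * p)) * ‖wompResidual D f₀ j k‖ ^ 2) :=
        mul_le_mul_of_nonneg_left (by linarith) (Real.exp_pos _).le
      rw [← mul_assoc, ← Real.exp_add] at h4
      have h5 : -ρ + -(ρ * p) = -(ρ * ((p + 1 : ℕ) : ℝ)) := by push_cast; ring
      rw [h5] at h4
      linarith

/-- Since `exp y ≥ 1 + y`, an exponent `y` with `1 ≤ ε * y` gives `exp (-y) ≤ ε`. The condition on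
`ε` is linear in `p / n`, so no logarithms enter the constant `C`. -/
lemma IsWOMP.norm_residual_sq_le_add (hα : 0 < α) (hαβ : α ≤ β) (ht : 0 < t)
    (hD : RestrictedIsometry D α β K) (hj : IsWOMP D t f₀ j) {S : Finset I} {k p n : ℕ}
    (hn : 0 < n) (hS : (S \ selectedIndices j k).card ≤ n) (hK : S.card + (k + p) ≤ K)
    {ε : ℝ} (hε : β * n ≤ ε * (t ^ 2 * α * p)) :
    ‖wompResidual D f₀ j (k + p)‖ ^ 2 ≤ ‖f₀ - ∑ i ∈ S, x i • D i‖ ^ 2 +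
      ε * ‖wompResidual D f₀ j k‖ ^ 2 := by
  have hβ : 0 < β := hα.trans_le hαβ
  have hn' : (0 : ℝ) < n := by exact_mod_cast hn
  refine (hj.norm_residual_sq_le_exp (x := x) hα hαβ ht hD hn hS hK).trans ?_
  gcongr
  set y := t ^ 2 * α / (β * n) * p with hy
  have hyε : 1 ≤ ε * y := by
    rw [hy, div_mul_eq_mul_div, mul_div_assoc', le_div_iff₀ (by positivity)]
    linarith
  have hy0 : 0 ≤ y := by positivity
  have hε0 : 0 < ε := by
    by_contra h
    nlinarith [mul_nonneg (sub_nonneg.2 (not_lt.1 h)) hy0]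
  rw [Real.exp_neg, inv_le_comm₀ (Real.exp_pos _) hε0, inv_le_iff_one_le_mul₀ hε0]
  refine hyε.trans (mul_comm ε y ▸ mul_le_mul_of_nonneg_right ?_ hε0.le)
  linarith [Real.add_one_le_exp y]

/-- If after `C * m` further iterations fewer than `m` of the `n` missing indices have been
found, for every `1 ≤ m ≤ n`, then the residual nevertheless vanishes. -/
lemma IsWOMP.residual_eq_zero_of_few_selected (hα : 0 < α) (hαβ : α ≤ β) (ht : 0 < t)
    (hD : RestrictedIsometry D α β K) (hj : IsWOMP D t f₀ j)
    (hf : f₀ = ∑ i ∈ T, x i • D i) {C k n : ℕ} (hC : 16 * β ^ 2 ≤ C * (t ^ 2 * α ^ 2))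
    (hn : (T \ selectedIndices j k).card = n) (hn0 : 0 < n) (hK : T.card + (k + C * n) ≤ K)
    (hfew : ∀ m, 1 ≤ m → m ≤ n →
      ((T \ selectedIndices j k) ∩ selectedIndices j (k + C * m)).card < m) :
    wompResidual D f₀ j (k + C * n) = 0 := by
  have hβ : 0 < β := hα.trans_le hαβ
  set E : ℕ → ℝ := fun m => ‖wompResidual D f₀ j (k + C * m)‖ ^ 2 with hE
  have hE0 : ∀ m, 0 ≤ E m := fun m => sq_nonneg _
  -- The scales are `0, 1, 2, 4, …`; truncating division makes the first one `0`.
  set M : ℕ → ℕ := fun l => 2 ^ l / 2 with hM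
  have hM1 : ∀ l, M (l + 1) = 2 ^ l := fun l => by simp [hM, pow_succ]
  have hMle : ∀ l, M l ≤ M (l + 1) := fun l => by rw [hM1]; exact Nat.div_le_self _ _
  have hM4 : ∀ l, M (l + 2) ≤ 4 * (M (l + 1) - M l) := fun l => by
    rcases l with _ | l
    · simp [hM]
    · rw [hM1, hM1, hM1, pow_succ, pow_succ]; omega
  have hstep : ∀ (l : ℕ) (S : Finset I), S ⊆ T → M (l + 1) ≤ n →
      (S \ selectedIndices j k).card ≤ M (l + 2) →
      E (M (l + 1)) ≤ ‖f₀ - ∑ i ∈ S, x i • D i‖ ^ 2 + α / (4 * β) * E (M l) := by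
    intro l S hST hln hcard
    have hsplit : k + C * M (l + 1) = k + C * M l + C * (M (l + 1) - M l) := by
      rw [add_assoc, ← mul_add, Nat.add_sub_cancel' (hMle l)]
    have hSc := Finset.card_le_card hST
    have hCm : C * M (l + 1) ≤ C * n := Nat.mul_le_mul_left C hln
    simp only [hE]
    rw [hsplit]
    refine hj.norm_residual_sq_le_add hα hαβ ht hD (n := M (l + 2))
      (by rw [hM1]; positivity) ?_ (by omega) ?_
    · exact (Finset.card_le_card (Finset.sdiff_subset_sdiff le_rfl
        (selectedIndices_mono j (Nat.le_add_right k _)))).trans hcard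
    -- The constant `16` arises here: a factor `4` from `ε = α / (4 * β)` and a factor `4` from
    -- comparing `M (l + 2)` with the scale increment.
    · have h4 : ((M (l + 2) : ℕ) : ℝ) ≤ 4 * ((M (l + 1) - M l : ℕ) : ℝ) := by
        exact_mod_cast hM4 l
      set w : ℝ := ((M (l + 1) - M l : ℕ) : ℝ) with hw
      have hw0 : 0 ≤ w := Nat.cast_nonneg _
      push_cast
      rw [div_mul_eq_mul_div, le_div_iff₀ (by positivity)]
      have h5 := mul_le_mul_of_nonneg_right hC hw0
      have h6 := mul_le_mul_of_nonneg_left h4 (by positivity : 0 ≤ 4 * β ^ 2)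
      linarith
  have hcomp : ∀ m, m ≤ n → ‖f₀ - ∑ i ∈ T ∩ selectedIndices j (k + C * m), x i • D i‖ ^ 2 ≤
      β / α * E m := fun m hm => by
    have hCm : C * m ≤ C * n := Nat.mul_le_mul_left C hm
    exact norm_sub_sum_inter_sq_le hα hβ hD hf (by omega)
  have hcard : ∀ m, 1 ≤ m → m ≤ n →
      ((T ∩ selectedIndices j (k + C * m)) \ selectedIndices j k).card < m := fun m h1 h2 => by
    have h3 : (T ∩ selectedIndices j (k + C * m)) \ selectedIndices j k =
        (T \ selectedIndices j k) ∩ selectedIndices j (k + C * m) := by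
      ext i
      simp only [Finset.mem_sdiff, Finset.mem_inter]
      tauto
    exact h3 ▸ hfew m h1 h2
  -- The residual cannot drop too fast from one scale to the next.
  have hgrow : ∀ l, M (l + 1) ≤ n → α / (2 * β) * E (M l) ≤ E (M (l + 1)) := by
    intro l
    induction l with
    | zero =>
      intro hl
      have hM0 : M 0 = 0 := by simp [hM]
      have hM01 : M (0 + 1) = 1 := by simp [hM]
      rw [hM01] at hl ⊢
      rw [hM0]
      -- With `m = 1` no new index of `T` has been found, so the competitor already lies in the span
      -- available at stage `0`.
      have h1 := hcard 1 le_rfl hl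
      have h2 : E 0 ≤ ‖f₀ - ∑ i ∈ T ∩ selectedIndices j (k + C * 1), x i • D i‖ ^ 2 := by
        have h3 : T ∩ selectedIndices j (k + C * 1) ⊆ selectedIndices j k := by
          rw [← Finset.sdiff_eq_empty_iff_subset, ← Finset.card_eq_zero]; omega
        simp only [hE]
        refine pow_le_pow_left₀ (norm_nonneg _) (norm_wompResidual_le D f₀ j _ ?_) 2
        rw [mul_zero, add_zero, wompSpace_eq]
        exact sum_smul_mem_span_image (by exact_mod_cast h3) x
      have h4 := h2.trans (hcomp 1 hl)
      rw [div_mul_eq_mul_div, le_div_iff₀ hα] at h4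
      rw [div_mul_eq_mul_div, div_le_iff₀ (by positivity)]
      have := mul_nonneg hβ.le (hE0 1)
      linarith
    | succ l ih =>
      intro hl
      have ih := ih ((hMle _).trans hl)
      have h1 := hstep l _ Finset.inter_subset_left ((hMle _).trans hl)
        (hcard (M (l + 2)) (by rw [hM1]; exact Nat.one_le_two_pow) hl).le
      have h2 := hcomp _ hl
      -- The induction hypothesis bounds the error term by half of the left side of `h1`, where it
      -- is absorbed.
      have h3 : α / (4 * β) * E (M l) ≤ E (M (l + 1)) / 2 := by
        have : α / (4 * β) * E (M l) = α / (2 * β) * E (M l) / 2 := by ring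
        rw [this]; linarith
      have h4 : E (M (l + 1)) / 2 ≤ β / α * E (M (l + 2)) := by linarith
      rw [div_mul_eq_mul_div, le_div_iff₀ hα] at h4
      rw [div_mul_eq_mul_div, div_le_iff₀ (by positivity)]
      linarith
  set L := Nat.log 2 n with hL
  have hL1 : M (L + 1) ≤ n := by rw [hM1]; exact Nat.pow_log_le_self 2 hn0.ne'
  have hL2 : n ≤ M (L + 2) := by rw [hM1]; exact (Nat.lt_pow_succ_log_self one_lt_two n).le
  -- At the last scale all of `T` is an admissible competitor, with error zero. The result, together
  -- with `hgrow`, gives `E (M (L + 1)) ≤ E (M (L + 1)) / 2`.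
  have h1 := hstep L T le_rfl hL1 (hn.le.trans hL2)
  rw [← hf, sub_self, norm_zero] at h1
  have h2 := hgrow L hL1
  have h3 : α / (4 * β) * E (M L) = α / (2 * β) * E (M L) / 2 := by ring
  have h4 : E (M (L + 1)) ≤ 0 := by linarith
  have h5 : E n ≤ E (M (L + 1)) := norm_wompResidual_sq_antitone D f₀ j
    (Nat.add_le_add_left (Nat.mul_le_mul_left C hL1) k)
  have h6 : E n = 0 := le_antisymm (h5.trans h4) (hE0 n)
  simpa [hE] using h6

/-- **Exact recovery by the Weak Orthogonal Matching Pursuit** under a restricted isometry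
property with arbitrary constants. -/
theorem IsWOMP.residual_eq_zero (hα : 0 < α) (hαβ : α ≤ β) (ht : 0 < t)
    (hD : RestrictedIsometry D α β K) (hj : IsWOMP D t f₀ j)
    (hf : f₀ = ∑ i ∈ T, x i • D i) {C : ℕ} (hC : 16 * β ^ 2 ≤ C * (t ^ 2 * α ^ 2))
    (hK : T.card + C * T.card ≤ K) :
    wompResidual D f₀ j (C * T.card) = 0 := by
  suffices h : ∀ n k, (T \ selectedIndices j k).card = n → k + C * n ≤ C * T.card →
      wompResidual D f₀ j (k + C * n) = 0 by
    have h0 := h T.card 0 (by simp [selectedIndices]) (by omega)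
    rwa [zero_add] at h0
  intro n
  induction n using Nat.strong_induction_on with
  | _ n ih =>
    intro k hn hk
    rcases Nat.eq_zero_or_pos n with rfl | hn0
    · have hsub : T ⊆ selectedIndices j k := by
        rwa [Finset.card_eq_zero, Finset.sdiff_eq_empty_iff_subset] at hn
      have hmem : f₀ ∈ wompSpace D j k := by
        rw [wompSpace_eq, hf]
        exact sum_smul_mem_span_image (by exact_mod_cast hsub) x
      simpa using norm_wompResidual_le D f₀ j k hmem
    -- Each missing index carries a budget of `C` iterations. If some block of `C * m` iterations
    -- finds `m` indices, it is covered by their budget and the induction continues from its end.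
    · by_cases hfew : ∀ m, 1 ≤ m → m ≤ n →
          ((T \ selectedIndices j k) ∩ selectedIndices j (k + C * m)).card < m
      · exact hj.residual_eq_zero_of_few_selected hα hαβ ht hD hf hC hn hn0 (by omega) hfew
      · push Not at hfew
        obtain ⟨m, hm1, hmn, hm⟩ := hfew
        have hcard : (T \ selectedIndices j (k + C * m)).card + m ≤ n := by
          have h1 : T \ selectedIndices j (k + C * m) ⊆
              (T \ selectedIndices j k) \ selectedIndices j (k + C * m) := fun i hi => by
            rw [Finset.mem_sdiff] at hi
            have := selectedIndices_mono j (Nat.le_add_right k (C * m))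
            simp only [Finset.mem_sdiff]
            exact ⟨⟨hi.1, fun h => hi.2 (this h)⟩, hi.2⟩
          have h2 := Finset.card_le_card h1
          have h3 := Finset.card_sdiff_add_card_inter (T \ selectedIndices j k)
            (selectedIndices j (k + C * m))
          omega
        set n' := (T \ selectedIndices j (k + C * m)).card with hn'
        have hle : k + C * m + C * n' ≤ k + C * n := by
          rw [add_assoc, ← mul_add]
          exact Nat.add_le_add_left (Nat.mul_le_mul_left C (by omega)) k
        have h0 := ih n' (by omega) (k + C * m) rfl (hle.trans hk)
        have := norm_wompResidual_antitone D f₀ j hle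
        simpa [h0] using this

end Recovery

/-! ### The discrete space: linearity of restriction and its norm -/

section SampleRestrict

variable {Ω : Type*} [MeasurableSpace Ω] [MeasurableSingletonClass Ω] {m : ℕ}

lemma sampleRestrict_add (ξ : Fin m → Ω) (f g : Ω → ℂ) :
    sampleRestrict ξ (f + g) = sampleRestrict ξ f + sampleRestrict ξ g := rfl

lemma sampleRestrict_smul (ξ : Fin m → Ω) (a : ℂ) (f : Ω → ℂ) :
    sampleRestrict ξ (a • f) = a • sampleRestrict ξ f := rfl

lemma sampleRestrict_sum_smul {I : Type*} (ξ : Fin m → Ω) (J : Finset I) (a : I → ℂ)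
    (φ : I → Ω → ℂ) :
    sampleRestrict ξ (∑ i ∈ J, a i • φ i) = ∑ i ∈ J, a i • sampleRestrict ξ (φ i) := by
  let S : (Ω → ℂ) →ₗ[ℂ] Lp ℂ 2 (sampleMeasure ξ) :=
    { toFun := sampleRestrict ξ
      map_add' := sampleRestrict_add ξ
      map_smul' := sampleRestrict_smul ξ }
  change S _ = ∑ i ∈ J, a i • S (φ i)
  rw [map_sum]
  exact Finset.sum_congr rfl fun i _ => map_smul S _ _

lemma norm_sampleRestrict_sq (ξ : Fin m → Ω) (f : Ω → ℂ) :
    ‖sampleRestrict ξ f‖ ^ 2 = (1 / (m : ℝ)) * ∑ ν, ‖f (ξ ν)‖ ^ 2 := by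
  have h : eLpNorm (fun x : Set.range ξ => f x) 2 (sampleMeasure ξ) ^ 2 =
      (m : ℝ≥0∞)⁻¹ * ∑ ν, ‖f (ξ ν)‖ₑ ^ 2 := by
    have h1 := eLpNorm_nnreal_pow_eq_lintegral (f := fun x : Set.range ξ => f x)
      (μ := sampleMeasure ξ) (p := 2) two_ne_zero
    simp only [NNReal.coe_ofNat, ENNReal.coe_ofNat, ENNReal.rpow_ofNat] at h1
    rw [h1, sampleMeasure, lintegral_smul_measure, lintegral_finsetSum_measure]
    simp only [lintegral_dirac, smul_eq_mul]
  rw [sampleRestrict, Lp.norm_toLp, ← ENNReal.toReal_pow, h, ENNReal.toReal_mul,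
    ENNReal.toReal_inv, ENNReal.toReal_natCast, one_div,
    ENNReal.toReal_sum fun ν _ => ENNReal.pow_ne_top enorm_ne_top]
  simp

end SampleRestrict

/-! ### From discretization to restricted isometry and injectivity on sparse functions -/

section Discretization

variable {Ω : Type*} [MeasurableSpace Ω] [MeasurableSingletonClass Ω] {μ : Measure Ω} {m N u : ℕ}
  {ξ : Fin m → Ω} {φ : Fin N → Ω → ℂ} {R₁ R₂ : ℝ}

/-- Universal discretization for a Riesz basis makes its restrictions to the sample points a
system with the restricted isometry property. -/
lemma IsUniformlyBoundedRieszBasis.restrictedIsometry (hφ : IsUniformlyBoundedRieszBasis μ φ R₁ R₂)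
    (hR₁ : 0 < R₁) (huN : u ≤ N) (hξ : UniversalDiscretization μ ξ (sparseSpaces φ u)) :
    RestrictedIsometry (fun i => sampleRestrict ξ (φ i)) (R₁ ^ 2 / 2) (3 * R₂ ^ 2 / 2) u := by
  intro J hJ a
  -- The discretized spaces have exactly `u` generators, so a smaller support is padded; this is
  -- where `u ≤ N` matters.
  obtain ⟨J', hJJ', hJ'⟩ := Finset.exists_superset_card_eq hJ (by simpa using huN)
  set f : Ω → ℂ := ∑ i ∈ J, a i • φ i with hf
  have hfmem : f ∈ Submodule.span ℂ (φ '' (J' : Set (Fin N))) :=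
    sum_smul_mem_span_image (by exact_mod_cast hJJ') a
  obtain ⟨hlow, hup⟩ := hξ _ ⟨J', hJ', rfl⟩ f hfmem
  rw [← norm_sampleRestrict_sq] at hlow hup
  rw [← sampleRestrict_sum_smul]
  set b : Fin N → ℂ := fun i => if i ∈ J then a i else 0 with hb
  have hfb : (fun x => ∑ i, b i * φ i x) = f := by
    ext x
    simp [hb, hf, Finset.sum_apply, ite_mul, Finset.sum_ite_mem]
  have hab : ∑ i, ‖b i‖ ^ 2 = ∑ i ∈ J, ‖a i‖ ^ 2 := by
    rw [← Finset.sum_subset (Finset.subset_univ J) fun i _ hi => by simp [hb, hi]]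
    exact Finset.sum_congr rfl fun i hi => by simp [hb, hi]
  have h1 := hφ.lower b
  have h2 := hφ.upper b
  rw [hfb, hab] at h1 h2
  have hs : 0 ≤ ∑ i ∈ J, ‖a i‖ ^ 2 := Finset.sum_nonneg fun i _ => sq_nonneg _
  have h3 := pow_le_pow_left₀ (mul_nonneg hR₁.le (Real.sqrt_nonneg _)) h1 2
  have h4 := pow_le_pow_left₀ ENNReal.toReal_nonneg h2 2
  rw [mul_pow, Real.sq_sqrt hs] at h3 h4
  change l2norm μ f ^ 2 ≤ _ at h4
  constructor <;> linarith

/-- The difference has a representation over `J`, and the lower isometry bound makes all its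
coefficients vanish. Equality therefore holds at every point of `Ω`, not merely almost everywhere.
-/
lemma eq_of_sampleRestrict_eq {α β : ℝ} (hα : 0 < α)
    (hD : RestrictedIsometry (fun i => sampleRestrict ξ (φ i)) α β u) {J : Finset (Fin N)}
    (hJ : J.card ≤ u) {f g : Ω → ℂ} (hf : f ∈ Submodule.span ℂ (φ '' (J : Set (Fin N))))
    (hg : g ∈ Submodule.span ℂ (φ '' (J : Set (Fin N))))
    (h : sampleRestrict ξ f = sampleRestrict ξ g) : f = g := by
  obtain ⟨a, -, ha⟩ := exists_coeff_of_mem_span_image (Submodule.sub_mem _ hf hg)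
  have h0 : sampleRestrict ξ (f - g) = 0 := by
    change sampleRestrict ξ f - sampleRestrict ξ g = 0
    rw [h, sub_self]
  have h1 := (hD J hJ a).1
  rw [← sampleRestrict_sum_smul, ha, h0, norm_zero] at h1
  have hs : 0 ≤ ∑ i ∈ J, ‖a i‖ ^ 2 := Finset.sum_nonneg fun i _ => sq_nonneg _
  have h2 : ∑ i ∈ J, ‖a i‖ ^ 2 = 0 := by nlinarith
  rw [Finset.sum_eq_zero_iff_of_nonneg fun i _ => sq_nonneg _] at h2
  rw [← sub_eq_zero, ← ha]
  exact Finset.sum_eq_zero fun i hi => by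
    rw [norm_eq_zero.1 (pow_eq_zero_iff two_ne_zero |>.1 (h2 i hi)), zero_smul]

end Discretization

/-! ### The main theorem -/

theorem corollary1p1 (t R₁ R₂ : ℝ) (ht₀ : 0 < t) (ht₁ : t ≤ 1) (hR₁ : 0 < R₁) (hR : R₁ ≤ R₂) :
    ∃ c : ℕ, 1 ≤ c ∧
      ∀ (Ω : Type*) [TopologicalSpace Ω] [LocallyCompactSpace Ω] [T2Space Ω]
        [MeasurableSpace Ω] [BorelSpace Ω] (μ : Measure Ω) [IsProbabilityMeasure μ]
        (N : ℕ) (φ : Fin N → Ω → ℂ), IsUniformlyBoundedRieszBasis μ φ R₁ R₂ →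
      ∀ u : ℕ, 1 ≤ u → u ≤ N →
      ∀ (m : ℕ) (ξ : Fin m → Ω), UniversalDiscretization μ ξ (sparseSpaces φ u) →
      ∀ v : ℕ, 1 ≤ v → (1 + c) * v ≤ u →
      ∀ f₀ ∈ sparseFunctions φ v,
      -- every run of the algorithm, whatever the choices it makes
      ∀ j : ℕ → Fin N,
        IsWOMP (fun i => sampleRestrict ξ (φ i)) t (sampleRestrict ξ f₀) j →
        -- the residual vanishes after `c * v` iterations
        wompResidual (fun i => sampleRestrict ξ (φ i)) (sampleRestrict ξ f₀) j (c * v) = 0 ∧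
        -- and `f₀` is the only combination of the selected dictionary elements, as functions
        -- on `Ω`, whose restriction is the approximant that the algorithm has found
        ∀ g : Ω → ℂ,
          (g ∈ Submodule.span ℂ ((fun i => φ (j i)) '' Set.Iio (c * v)) ∧
            sampleRestrict ξ g =
              wompApprox (fun i => sampleRestrict ξ (φ i)) (sampleRestrict ξ f₀) j (c * v)) ↔
          g = f₀ := by
  set α : ℝ := R₁ ^ 2 / 2 with hα_def
  set β : ℝ := 3 * R₂ ^ 2 / 2 with hβ_def
  have hα : 0 < α := by positivity
  have hαβ : α ≤ β := by
    have := pow_le_pow_left₀ hR₁.le hR 2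
    have := sq_nonneg R₂
    rw [hα_def, hβ_def]
    linarith
  -- In terms of the data this is `144 * R₂ ^ 4 / (t ^ 2 * R₁ ^ 4)`, rounded up.
  set C : ℕ := ⌈16 * β ^ 2 / (t ^ 2 * α ^ 2)⌉₊ with hC_def
  have hβ : 0 < β := hα.trans_le hαβ
  have hC : 16 * β ^ 2 ≤ C * (t ^ 2 * α ^ 2) := by
    rw [← div_le_iff₀ (by positivity)]
    exact Nat.le_ceil _
  refine ⟨C, Nat.ceil_pos.2 (by positivity), ?_⟩
  intro Ω _ _ _ _ _ μ _ N φ hφ u _ huN m ξ hξ v _ hvu f₀ hf₀ j hj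
  have hD := hφ.restrictedIsometry hR₁ huN hξ
  simp only [sparseFunctions, sparseSpaces, Set.mem_ofPred_eq, Set.mem_iUnion, SetLike.mem_coe,
    exists_prop] at hf₀
  obtain ⟨_, ⟨T, rfl, rfl⟩, hf₀⟩ := hf₀
  obtain ⟨x, -, hx⟩ := exists_coeff_of_mem_span_image hf₀
  have hx' : sampleRestrict ξ f₀ = ∑ i ∈ T, x i • sampleRestrict ξ (φ i) := by
    rw [← hx, sampleRestrict_sum_smul]
  have hcard : T.card + C * T.card ≤ u := by linarith
  have hres := hj.residual_eq_zero hα hαβ ht₀ hD hx' hC hcard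
  have happrox := (sub_eq_zero.1 hres).symm
  refine ⟨hres, fun g => ?_⟩
  rw [happrox]
  set F := selectedIndices j (C * T.card) with hF
  rw [← image_selectedIndices φ j (C * T.card), ← hF]
  -- The condition `(1 + c) * v ≤ u` leaves room for the true support and all selected indices
  -- together, so `f₀` and any `g` over `F` can be compared.
  have hTF : (T ∪ F).card ≤ u := (Finset.card_union_le _ _).trans
    ((Nat.add_le_add_left (card_selectedIndices_le j _) _).trans hcard)
  have hFsub : Submodule.span ℂ (φ '' (F : Set (Fin N))) ≤
      Submodule.span ℂ (φ '' ((T ∪ F : Finset (Fin N)) : Set (Fin N))) :=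
    Submodule.span_mono (Set.image_mono (by simp))
  have hTsub : Submodule.span ℂ (φ '' (T : Set (Fin N))) ≤
      Submodule.span ℂ (φ '' ((T ∪ F : Finset (Fin N)) : Set (Fin N))) :=
    Submodule.span_mono (Set.image_mono (by simp))
  have huniq : ∀ g ∈ Submodule.span ℂ (φ '' (F : Set (Fin N))),
      sampleRestrict ξ g = sampleRestrict ξ f₀ → g = f₀ := fun g hg h =>
    eq_of_sampleRestrict_eq hα hD hTF (hFsub hg) (hTsub hf₀) h
  refine ⟨fun h => huniq g h.1 h.2, ?_⟩
  rintro rfl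
  refine ⟨?_, rfl⟩
  -- Membership of `f₀` in the selected span: coefficients of the approximant define a function on
  -- `Ω` with the same restriction as `f₀`, which uniqueness identifies with `f₀`.
  have hmem := wompApprox_mem (fun i => sampleRestrict ξ (φ i)) (sampleRestrict ξ g) j
    (C * T.card)
  rw [happrox, wompSpace_eq, ← hF] at hmem
  obtain ⟨y, -, hy⟩ := exists_coeff_of_mem_span_image hmem
  rw [← sampleRestrict_sum_smul] at hy
  have hspan : ∑ i ∈ F, y i • φ i ∈ Submodule.span ℂ (φ '' (F : Set (Fin N))) :=
    sum_smul_mem_span_image le_rfl y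
  exact huniq _ hspan hy ▸ hspan
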